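/- For $K\subseteq\mathbb{R}^n$ let $\mathrm{dist}_K(x)=\inf\{\|x-y\|:y\in K\}$, let $\mathrm{proj}_K(x)$ be the set of $y\in K$ with $\|x-y\|=\mathrm{dist}_K(x)$ (identified with its element when it has exactly one), and let $\mathrm{reach}(K)\in[0,\infty]$ be the largest $\tau$ such that $\mathrm{proj}_K(x)$ consists of exactly one point whenever $\mathrm{dist}_K(x)<\tau$. There is an absolute constant $\alpha>0$ such that the following holds. Let $K\subseteq\mathbb{R}^n$ be a set that has a $d$-dimensional tangent space at each of its points, i.e. for every $x\in K$ the tangent cone of $K$ at $x$ (the set of limits of $c_k(y_k-x)$ with $c_k\ge 0$, $y_k\in K$, $y_k\to x$) is a linear subspace of dimension $d$; for example, $K$ may be any embedded $d$-dimensional $C^1$ submanifold of $\mathbb{R}^n$ without boundary. Let $\sigma>0$, $t>0$, $\kappa(t)=\sqrt{(\sqrt d+t)^2+(\sqrt{n-d}+t)^2}$, and suppose that $$\mathrm{reach}(K)>\sigma\kappa(t)\qquad\text{and}\qquad \sqrt{n-d}-\sqrt d-2t>0 .$$ Let $x_0\in K$, $\epsilon\sim\mathcal N(0,I_n)$ and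 $x_\sigma=x_0+\sigma\epsilon$. Then with probability at least $(1-e^{-\alpha t^2})^2$, all of the following hold simultaneously: $$\sigma(\sqrt{n-d}-\sqrt d-2t)\le \mathrm{dist}_K(x_\sigma)\le\sigma(\sqrt{n-d}+\sqrt d+2t),$$ the projection $\mathrm{proj}_K(x_\sigma)$ is a single point, and $$\|\mathrm{proj}_K(x_\sigma)-x_0\|\le\frac{C(t)\,(\sqrt d+t)}{\sqrt{n-d}-\sqrt d-2t}\,\mathrm{dist}_K(x_\sigma),$$ where $C(t)=\dfrac{\mathrm{reach}(K)}{\mathrm{reach}(K)-\sigma\kappa(t)}$ (and $C(t)=1$ if $\mathrm{reach}(K)=\infty$). -/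

import Mathlib

open MeasureTheory ProbabilityTheory
open scoped ENNReal NNReal

noncomputable section

/-- The projection of `x` onto `K`, as a set: all points of `K` at which the distance
`dist_K(x) = inf {‖x - y‖ : y ∈ K}` (here `Metric.infDist x K`) is attained. -/
def proj {n : ℕ} (K : Set (EuclideanSpace ℝ (Fin n))) (x : EuclideanSpace ℝ (Fin n)) :
    Set (EuclideanSpace ℝ (Fin n)) :=
  {y | y ∈ K ∧ Metric.infDist x K = ‖x - y‖}

/-- The reach of `K`: the largest `τ ∈ [0, ∞]` such that every point at distance less than `τ`
from `K` has exactly one nearest point in `K`. -/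
def reach {n : ℕ} (K : Set (EuclideanSpace ℝ (Fin n))) : ℝ≥0∞ :=
  sSup {τ : ℝ≥0∞ | ∀ x : EuclideanSpace ℝ (Fin n),
    ENNReal.ofReal (Metric.infDist x K) < τ → ∃ p, proj K x = {p}}

/-- `K` has a `d`-dimensional tangent space at each of its points: the tangent cone
`Tan_K(x)` (the limits of `c_k (y_k - x)` with `c_k ≥ 0`, `y_k ∈ K`, `y_k → x`) is a linear subspace
of dimension `d`. Embedded `C¹` submanifolds of dimension `d` (without boundary) have this
property; no smoothness beyond the existence of the tangent spaces is asked for. -/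
def HasTangentSpacesOfDim {n : ℕ} (d : ℕ) (K : Set (EuclideanSpace ℝ (Fin n))) : Prop :=
  ∀ x ∈ K, ∃ T : Submodule ℝ (EuclideanSpace ℝ (Fin n)),
    posTangentConeAt K x = (T : Set (EuclideanSpace ℝ (Fin n))) ∧ Module.finrank ℝ T = d

/-- `κ(t) = √((√d + t)² + (√(n - d) + t)²)`. -/
def kappa (n d : ℕ) (t : ℝ) : ℝ :=
  √((√(d : ℝ) + t) ^ 2 + (√((n : ℝ) - (d : ℝ)) + t) ^ 2)

/-- The factor `r / (r - h)`, equal to `1` (its limit) when `r = ∞`. -/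
def reachFactor (r : ℝ≥0∞) (h : ℝ) : ℝ :=
  if r = ∞ then 1 else r.toReal / (r.toReal - h)

end

/-!
The displacement `σ • ε` is split into its component in the tangent space `T` at `x₀` and its
component in `Tᗮ`. These are independent standard Gaussian vectors (`stdGaussian_eq_map_add`), whose
norms concentrate around `√d` and `√(n - d)`; on the event where both are within `t` of these values
(from above only, for the tangential one) the claims hold deterministically (`projection_bounds`).

*Geometry.* Two facts of Federer about a set `K` of positive reach are needed. The first
(`two_mul_inner_le`) is that at a nearest point `p` of `x` the ball of any radius `r < reach K`
touching `K` at `p` on the side of `x` misses `K`. It amounts to prolonging the segment from `p`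
through `x` without changing the nearest point. In place of the usual integration of the gradient of
the distance function, `infDist_extend` maximizes the distance to `K` over a small ball around a
point `y` of the segment: the distance increases in every direction acute to the outward normal, so
a maximizer `z` can only be the point of the ball in its own outward normal direction, whence `y`
lies between `z` and the nearest point of `z`. Adding the inequality at two nearest points gives the
Lipschitz bound `reach / (reach - h)` for the projection (`norm_sub_le_reachFactor_mul`). The second
fact (`infDist_add_normal`) is that `x₀` is a nearest point of `x₀ + w` for every `w` normal to `T`
of norm below the reach; it follows from the first by a blow-up at `x₀`. Comparing
`x₀ + σ • ε` with `x₀ + w`, where `w` is the normal part of `σ • ε`, gives the lower bound on the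
distance and the bound on the projection.

*Probability.* The Chernoff bound for `‖g‖ ^ 2` gives each tail `exp (-t ^ 2 / 2)`. The tangential
norm needs only the upper tail. For the normal norm both tails matter, and the bound
`1 - 2 * exp (-t ^ 2 / 2)` is void for small `t`, where `1 - exp (-α * t ^ 2)` is still positive. There
one uses that an annulus `√m ≤ ‖x‖ < √m + t` has measure at least a constant times `t`: dilations
outside the ball of radius `√m` do not increase the Gaussian measure
(`stdGaussian_preimage_inv_smul_le`), so the at most `10 / t` dilates of the annulus needed to cover
`√m ≤ ‖x‖ < √m + 5` are all no larger than the annulus itself, while that wide annulus carries a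
constant mass (`le_stdGaussian_real_sqrt_le_norm`).
-/

/-! ### Sets of positive reach -/

section Geometry

open Metric Filter Topology
open scoped RealInnerProductSpace

variable {n : ℕ} {K : Set (EuclideanSpace ℝ (Fin n))}

theorem exists_proj_eq_singleton {x : EuclideanSpace ℝ (Fin n)}
    (h : ENNReal.ofReal (infDist x K) < reach K) : ∃ p, proj K x = {p} := by
  obtain ⟨τ, hτ, hlt⟩ := lt_sSup_iff.1 h
  exact hτ x hlt

/-- Points of the closure have distance `0`, so they have a nearest point in `K`. -/
theorem isClosed_of_reach_pos (h : 0 < reach K) : IsClosed K := by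
  rcases K.eq_empty_or_nonempty with rfl | hne
  · exact isClosed_empty
  refine isClosed_of_closure_subset fun x hx => ?_
  have h0 : infDist x K = 0 := (mem_closure_iff_infDist_zero hne).1 hx
  obtain ⟨p, hp⟩ := exists_proj_eq_singleton (K := K) (x := x) (by simpa [h0] using h)
  have hpK : p ∈ proj K x := by simp [hp]
  have : x = p := by
    have h1 := hpK.2
    rw [h0, eq_comm, norm_eq_zero, sub_eq_zero] at h1
    exact h1
  exact this ▸ hpK.1

theorem norm_sub_le_of_mem_proj {x p b : EuclideanSpace ℝ (Fin n)} (hp : p ∈ proj K x)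
    (hb : b ∈ K) : ‖x - p‖ ≤ ‖x - b‖ := by
  rw [← hp.2, ← dist_eq_norm]
  exact infDist_le_dist_of_mem hb

theorem proj_nonempty (hK : IsClosed K) (hne : K.Nonempty) (x : EuclideanSpace ℝ (Fin n)) :
    (proj K x).Nonempty := by
  obtain ⟨y, hy, h⟩ := hK.exists_infDist_eq_dist hne x
  exact ⟨y, hy, by rw [h, dist_eq_norm]⟩

/-- Where the nearest point is unique, the projection is continuous. -/
theorem proj_continuous (hK : IsClosed K) {z q : EuclideanSpace ℝ (Fin n)} (hq : proj K z = {q})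
    {η : ℝ} (hη : 0 < η) :
    ∃ δ > 0, ∀ z' p', dist z' z < δ → p' ∈ proj K z' → dist p' q < η := by
  have hK' : IsClosed (K \ ball q η) := hK.sdiff isOpen_ball
  rcases (K \ ball q η).eq_empty_or_nonempty with he | hne
  · refine ⟨1, one_pos, fun z' p' _ hp' => ?_⟩
    by_contra hcon
    have : p' ∈ K \ ball q η := ⟨hp'.1, by simpa using hcon⟩
    simp [he] at this
  obtain ⟨k, hk, hkd⟩ := hK'.exists_infDist_eq_dist hne z
  -- The part of `K` away from `q` is at a definitely larger distance from `z` than `K` itself.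
  have hgap : infDist z K < dist z k := by
    refine lt_of_le_of_ne (infDist_le_dist_of_mem hk.1) fun heq => ?_
    have : k ∈ proj K z := ⟨hk.1, by rw [heq, dist_eq_norm]⟩
    rw [hq, Set.mem_singleton_iff] at this
    exact hk.2 (by simpa [this] using hη)
  refine ⟨(dist z k - infDist z K) / 2, by linarith, fun z' p' hz' hp' => ?_⟩
  by_contra hcon
  have hp'K : p' ∈ K \ ball q η := ⟨hp'.1, by simpa using hcon⟩
  have h1 : dist z k ≤ dist z p' := hkd ▸ infDist_le_dist_of_mem hp'K
  have h2 := dist_triangle z z' p'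
  have h3 : dist z' p' = infDist z' K := by rw [hp'.2, dist_eq_norm]
  have h4 : infDist z' K ≤ infDist z K + dist z' z := infDist_le_infDist_add_dist
  rw [dist_comm z z'] at h2
  linarith

/-- The distance to `K` strictly increases in every direction that makes an acute angle with the
direction away from the (unique) nearest point. -/
theorem exists_infDist_lt_infDist_add_smul (hK : IsClosed K) {z q h : EuclideanSpace ℝ (Fin n)}
    (hq : proj K z = {q}) (hh : 0 < ⟪h, z - q⟫) :
    ∃ ε : ℝ, 0 < ε ∧ ε ≤ 1 ∧ infDist z K < infDist (z + ε • h) K := by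
  have hqm : q ∈ proj K z := by simp [hq]
  have hne : K.Nonempty := ⟨q, hqm.1⟩
  have hh0 : 0 < ‖h‖ := norm_pos_iff.2 fun h0 => by simp [h0] at hh
  obtain ⟨δ, hδ, hcont⟩ := proj_continuous hK hq (η := ⟪h, z - q⟫ / ‖h‖) (by positivity)
  refine ⟨min 1 (δ / (2 * ‖h‖)), by positivity, min_le_left _ _, ?_⟩
  set ε := min 1 (δ / (2 * ‖h‖)) with hε
  have hε0 : 0 < ε := by positivity
  have hdist : dist (z + ε • h) z < δ := by
    rw [dist_eq_norm, add_sub_cancel_left, norm_smul, Real.norm_of_nonneg hε0.le]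
    calc ε * ‖h‖ ≤ δ / (2 * ‖h‖) * ‖h‖ := by gcongr; exact min_le_right _ _
      _ = δ / 2 := by field_simp
      _ < δ := by linarith
  obtain ⟨p', hp'⟩ := proj_nonempty hK hne (z + ε • h)
  have hpq := hcont _ _ hdist hp'
  have hpos : 0 < ⟪h, z - p'⟫ := by
    have e : ⟪h, z - p'⟫ = ⟪h, z - q⟫ - ⟪h, p' - q⟫ := by
      rw [← inner_sub_right]; congr 1; abel
    have h1 : ⟪h, p' - q⟫ ≤ ‖h‖ * ‖p' - q‖ := real_inner_le_norm _ _
    rw [dist_eq_norm, lt_div_iff₀ hh0] at hpq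
    rw [e]; linarith
  rw [hqm.2, hp'.2]
  refine (norm_sub_le_of_mem_proj hqm hp'.1).trans_lt ?_
  refine lt_of_pow_lt_pow_left₀ 2 (norm_nonneg _) ?_
  have e : z + ε • h - p' = (z - p') + ε • h := by abel
  rw [e, norm_add_sq_real, inner_smul_right, real_inner_comm]
  have := mul_pos hε0 hpos
  nlinarith [sq_nonneg ‖ε • h‖]

/-- One step of the extension of a normal segment. A point `z` of the ball `closedBall y δ` at
maximal distance from `K` must be `y + δ • w`, with `w` the unit vector at `z` pointing away from
the nearest point `q`; then `y` lies on the segment from `q` to `z`, so that `q` is also the nearest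
point to `y`. -/
theorem infDist_extend {y p : EuclideanSpace ℝ (Fin n)} {δ : ℝ} (hp : proj K y = {p})
    (hδ : 0 < δ) (hδy : δ < infDist y K) (hr : ENNReal.ofReal (infDist y K + δ) < reach K) :
    infDist (y + (δ / infDist y K) • (y - p)) K = infDist y K + δ := by
  have hK : IsClosed K := isClosed_of_reach_pos (pos_of_gt hr)
  obtain ⟨z, hz, hmax⟩ := (isCompact_closedBall y δ).exists_isMaxOn
    ⟨y, mem_closedBall_self hδ.le⟩ (continuous_infDist_pt K).continuousOn
  have hyz : infDist y K ≤ infDist z K := hmax (mem_closedBall_self hδ.le)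
  have hzy : infDist z K ≤ infDist y K + δ :=
    infDist_le_infDist_add_dist.trans (by gcongr; exact hz)
  obtain ⟨q, hq⟩ := exists_proj_eq_singleton (K := K) (x := z)
    ((ENNReal.ofReal_le_ofReal hzy).trans_lt hr)
  have hqm : q ∈ proj K z := by simp [hq]
  have hs : 0 < infDist z K := by linarith
  have hsq : 0 < ‖z - q‖ := hqm.2 ▸ hs
  set w := ‖z - q‖⁻¹ • (z - q) with hw
  have hw1 : ‖w‖ = 1 := by
    rw [hw, norm_smul, norm_inv, norm_norm, inv_mul_cancel₀ hsq.ne']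
  have hzq : z - q = ‖z - q‖ • w := by rw [hw, smul_smul, mul_inv_cancel₀ hsq.ne', one_smul]
  -- Moving from `z` towards `y + δ • w` would otherwise increase the distance inside the ball.
  have hzw : z = y + δ • w := by
    by_contra hcon
    have hm : ‖z - y‖ ≤ δ := by simpa [dist_eq_norm] using hz
    have hpos : 0 < ⟪y + δ • w - z, z - q⟫ := by
      rw [hzq, inner_smul_right]
      refine mul_pos hsq ?_
      have e : ⟪y + δ • w - z, w⟫ = δ - ⟪z - y, w⟫ := by
        have : y + δ • w - z = δ • w - (z - y) := by abel
        rw [this, inner_sub_left, real_inner_smul_left, real_inner_self_eq_norm_sq, hw1]; ring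
      rw [e]
      have hne : 0 < ‖(z - y) - δ • w‖ ^ 2 := by
        refine pow_pos (norm_pos_iff.2 fun h0 => hcon ?_) 2
        rw [sub_eq_zero] at h0
        rw [← h0]; abel
      rw [norm_sub_sq_real, inner_smul_right, norm_smul, hw1, Real.norm_of_nonneg hδ.le] at hne
      have h2 : ‖z - y‖ ^ 2 ≤ δ ^ 2 := by gcongr
      have h3 : 0 < δ * (δ - ⟪z - y, w⟫) := by nlinarith
      exact pos_of_mul_pos_right h3 hδ.le
    obtain ⟨ε, hε0, hε1, hlt⟩ := exists_infDist_lt_infDist_add_smul hK hq hpos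
    have hmem : z + ε • (y + δ • w - z) ∈ closedBall y δ := by
      refine (convex_closedBall y δ).add_smul_sub_mem hz ?_ ⟨hε0.le, hε1⟩
      simp [norm_smul, hw1, abs_of_pos hδ]
    exact absurd (hmax hmem) (not_le.2 hlt)
  have hyq : y - q = (‖z - q‖ - δ) • w := by
    rw [sub_smul, ← hzq, hzw]; abel
  have hnyq : ‖y - q‖ = ‖z - q‖ - δ := by
    rw [hyq, norm_smul, hw1, mul_one, Real.norm_of_nonneg]
    rw [← hqm.2]; linarith
  have hqp : q = p := by
    have : q ∈ proj K y := by
      refine ⟨hqm.1, le_antisymm ?_ ?_⟩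
      · rw [← dist_eq_norm]; exact infDist_le_dist_of_mem hqm.1
      · rw [hnyq, ← hqm.2]; linarith
    simpa [hp] using this
  subst hqp
  have hqy : q ∈ proj K y := by simp [hp]
  have hyn : infDist y K = ‖z - q‖ - δ := hqy.2.trans hnyq
  have : y + (δ / infDist y K) • (y - q) = z := by
    rw [hyq, smul_smul, hyn, div_mul_cancel₀ _ (by rw [← hyn]; linarith), ← hzw]
  rw [this, hqm.2, hyn]; ring

/-- A segment issuing from `p` along which `p` is the nearest point can be prolonged up to any
length below the reach. -/
theorem infDist_add_smul_of_lt_reach {x p w : EuclideanSpace ℝ (Fin n)} {r : ℝ}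
    (hp : p ∈ proj K x) (hx : 0 < infDist x K) (hw : x - p = infDist x K • w)
    (hxr : infDist x K ≤ r) (hr : ENNReal.ofReal r < reach K) :
    infDist (p + r • w) K = r := by
  set s₀ := infDist x K with hs₀
  have hw1 : ‖w‖ = 1 := by
    have h1 := hp.2
    rw [hw, norm_smul, Real.norm_of_nonneg hx.le, ← hs₀] at h1
    exact mul_left_cancel₀ hx.ne' (by rw [← h1, mul_one])
  -- The prolongation holds on a closed set of lengths; its maximum cannot be less than `r`.
  set I : Set ℝ := Set.Icc s₀ r ∩ {s | infDist (p + s • w) K = s} with hI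
  have hIc : IsCompact I := by
    refine isCompact_Icc.inter_right (isClosed_eq ?_ continuous_id)
    exact (continuous_infDist_pt K).comp (by fun_prop)
  have hIne : I.Nonempty := by
    refine ⟨s₀, ⟨le_rfl, hxr⟩, ?_⟩
    change infDist (p + s₀ • w) K = s₀
    rw [← hw, add_sub_cancel]
  obtain ⟨s, ⟨⟨hs0, hsr⟩, hs⟩, hsmax⟩ := hIc.exists_isGreatest hIne
  change infDist (p + s • w) K = s at hs
  rcases hsr.eq_or_lt with rfl | hlt
  · exact hs
  exfalso
  have hspos : 0 < s := hx.trans_le hs0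
  set δ := min (s / 2) (r - s) with hδ
  have hδ0 : 0 < δ := lt_min (by linarith) (by linarith)
  have hδ1 : δ ≤ s / 2 := min_le_left _ _
  have hδ2 : δ ≤ r - s := min_le_right _ _
  have hy : proj K (p + s • w) = {p} := by
    obtain ⟨q, hq⟩ := exists_proj_eq_singleton (K := K) (x := p + s • w)
      ((ENNReal.ofReal_le_ofReal (hs.le.trans hsr)).trans_lt hr)
    have : p ∈ proj K (p + s • w) := by
      refine ⟨hp.1, ?_⟩
      rw [hs, add_sub_cancel_left, norm_smul, hw1, mul_one, Real.norm_of_nonneg hspos.le]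
    rw [hq, Set.mem_singleton_iff] at this
    rw [hq, this]
  have hext := infDist_extend hy hδ0 (by rw [hs]; linarith)
    ((ENNReal.ofReal_le_ofReal (by rw [hs]; linarith)).trans_lt hr)
  have e : p + s • w + (δ / s) • (p + s • w - p) = p + (s + δ) • w := by
    rw [add_sub_cancel_left, smul_smul, div_mul_cancel₀ _ hspos.ne', add_smul, add_assoc]
  rw [hs, e] at hext
  have hmem : s + δ ∈ I := ⟨⟨by linarith, by linarith⟩, hext⟩
  linarith [hsmax hmem]

/-- Federer's inequality for the normal direction at a nearest point: the open ball of radius `r`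
tangent to `K` at `p` on the side of `x` misses `K`. -/
theorem two_mul_inner_le {x p b : EuclideanSpace ℝ (Fin n)} {r : ℝ} (hp : p ∈ proj K x)
    (hb : b ∈ K) (hxr : infDist x K ≤ r) (hr : ENNReal.ofReal r < reach K) :
    2 * r * ⟪x - p, b - p⟫ ≤ ‖b - p‖ ^ 2 * ‖x - p‖ := by
  rcases (infDist_nonneg (x := x) (s := K)).eq_or_lt with h0 | hpos
  · have : x - p = 0 := by rw [← norm_eq_zero, ← hp.2, ← h0]
    simp [this]
  set s := infDist x K with hs
  set w := s⁻¹ • (x - p) with hw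
  have hxw : x - p = s • w := by rw [hw, smul_smul, mul_inv_cancel₀ hpos.ne', one_smul]
  have hw1 : ‖w‖ = 1 := by
    rw [hw, norm_smul, ← hp.2, norm_inv, Real.norm_of_nonneg hpos.le, inv_mul_cancel₀ hpos.ne']
  have hd := infDist_add_smul_of_lt_reach hp hpos hxw hxr hr
  have h1 : r ≤ ‖r • w - (b - p)‖ := by
    have : r • w - (b - p) = p + r • w - b := by abel
    rw [this, ← dist_eq_norm]
    exact hd.symm.le.trans (infDist_le_dist_of_mem hb)
  have hr0 : 0 < r := hpos.trans_le hxr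
  have h2 : r ^ 2 ≤ ‖r • w - (b - p)‖ ^ 2 := by gcongr
  rw [norm_sub_sq_real, norm_smul, hw1, real_inner_smul_left, Real.norm_of_nonneg hr0.le] at h2
  rw [← hp.2, hxw, real_inner_smul_left]
  nlinarith

/-- The Lipschitz bound for the projection on the tube of radius `h`, with any `r < reach K` in place
of the reach: add `two_mul_inner_le` at `p` towards `a` and at `a` towards `p`. -/
theorem sub_mul_norm_sub_le {x y p a : EuclideanSpace ℝ (Fin n)} {r h : ℝ} (hp : p ∈ proj K x)
    (ha : a ∈ proj K y) (hx : infDist x K ≤ h) (hy : infDist y K ≤ h) (hhr : h ≤ r)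
    (hr : ENNReal.ofReal r < reach K) :
    (r - h) * ‖p - a‖ ≤ r * ‖x - y‖ := by
  have hr0 : 0 ≤ r := infDist_nonneg.trans (hx.trans hhr)
  rcases (norm_nonneg (p - a)).eq_or_lt with h0 | hpos
  · rw [← h0, mul_zero]; positivity
  have h1 := two_mul_inner_le hp ha.1 (hx.trans hhr) hr
  have h2 := two_mul_inner_le ha hp.1 (hy.trans hhr) hr
  rw [← hp.2] at h1
  rw [← ha.2] at h2
  have e : ⟪x - p, a - p⟫ + ⟪y - a, p - a⟫ = ‖p - a‖ ^ 2 - ⟪x - y, p - a⟫ := by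
    rw [← neg_sub p a, inner_neg_right, ← real_inner_self_eq_norm_sq, neg_add_eq_sub,
      ← inner_sub_left, ← inner_sub_left]
    congr 1; abel
  rw [norm_sub_rev a p] at h1
  have h3 : ⟪x - y, p - a⟫ ≤ ‖x - y‖ * ‖p - a‖ := real_inner_le_norm _ _
  have h4 : ‖p - a‖ ^ 2 * infDist x K ≤ ‖p - a‖ ^ 2 * h := by gcongr
  have h5 : ‖p - a‖ ^ 2 * infDist y K ≤ ‖p - a‖ ^ 2 * h := by gcongr
  have h6 : r * ⟪x - y, p - a⟫ ≤ r * (‖x - y‖ * ‖p - a‖) := by gcongr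
  refine le_of_mul_le_mul_right ?_ hpos
  nlinarith

/-- Federer's Lipschitz bound, from `sub_mul_norm_sub_le` as `r` tends to the reach. -/
theorem norm_sub_le_reachFactor_mul {x y p a : EuclideanSpace ℝ (Fin n)} {h : ℝ} (hp : p ∈ proj K x)
    (ha : a ∈ proj K y) (hx : infDist x K ≤ h) (hy : infDist y K ≤ h)
    (hr : ENNReal.ofReal h < reach K) :
    ‖p - a‖ ≤ reachFactor (reach K) h * ‖x - y‖ := by
  have hh : 0 ≤ h := infDist_nonneg.trans hx
  unfold reachFactor
  split_ifs with htop
  · have hall : ∀ᶠ r : ℝ in atTop, (1 - h / r) * ‖p - a‖ ≤ 1 * ‖x - y‖ := by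
      filter_upwards [eventually_ge_atTop h, eventually_gt_atTop 0] with r hhr hr0
      have := sub_mul_norm_sub_le hp ha hx hy hhr (by rw [htop]; exact ENNReal.ofReal_lt_top)
      refine le_of_mul_le_mul_left ?_ hr0
      calc r * ((1 - h / r) * ‖p - a‖) = (r - h) * ‖p - a‖ := by field_simp
        _ ≤ _ := by linarith
    refine le_of_tendsto ?_ hall
    have : Tendsto (fun r : ℝ => (1 - h / r) * ‖p - a‖) atTop (𝓝 ((1 - 0) * ‖p - a‖)) :=
      (tendsto_const_nhds.sub (tendsto_const_nhds.div_atTop tendsto_id)).mul_const _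
    simpa using this
  · set R := (reach K).toReal with hR
    have hRK : ENNReal.ofReal R = reach K := ENNReal.ofReal_toReal htop
    have hhR : h < R := (ENNReal.ofReal_lt_iff_lt_toReal hh htop).1 hr
    have hall : ∀ᶠ r : ℝ in 𝓝[<] R, (r - h) * ‖p - a‖ ≤ r * ‖x - y‖ := by
      filter_upwards [Ioo_mem_nhdsLT hhR] with r hrr
      exact sub_mul_norm_sub_le hp ha hx hy hrr.1.le
        ((ENNReal.ofReal_lt_iff_lt_toReal (hh.trans hrr.1.le) htop).2 hrr.2)
    have hlim : (R - h) * ‖p - a‖ ≤ R * ‖x - y‖ := by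
      refine le_of_tendsto_of_tendsto (b := 𝓝[<] R) ?_ ?_ hall
      · exact (Continuous.tendsto (f := fun r : ℝ => (r - h) * ‖p - a‖) (by fun_prop) R).mono_left
          nhdsWithin_le_nhds
      · exact (Continuous.tendsto (f := fun r : ℝ => r * ‖x - y‖) (by fun_prop) R).mono_left
          nhdsWithin_le_nhds
    rw [div_mul_eq_mul_div, le_div_iff₀ (by linarith), mul_comm]
    exact hlim

/-- A vector with `⟪v, b - a⟫ = O(‖b - a‖²)` on `K` is nonpositive on the tangent cone at `a`. -/
theorem inner_nonpos_of_mem_posTangentConeAt {a v τ : EuclideanSpace ℝ (Fin n)} {C : ℝ}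
    (hv : ∀ b ∈ K, ⟪v, b - a⟫ ≤ C * ‖b - a‖ ^ 2) (hτ : τ ∈ posTangentConeAt K a) :
    ⟪v, τ⟫ ≤ 0 := by
  obtain ⟨α, l, hl, c, d, hd0, hdK, hcd⟩ := exists_fun_of_mem_tangentConeAt hτ
  have h1 : Tendsto (fun i => ⟪v, c i • d i⟫) l (𝓝 ⟪v, τ⟫) := tendsto_const_nhds.inner hcd
  have h2 : Tendsto (fun i => C * (‖c i • d i‖ * ‖d i‖)) l (𝓝 0) := by
    simpa using (hcd.norm.mul hd0.norm).const_mul C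
  refine le_of_tendsto_of_tendsto h1 h2 ?_
  filter_upwards [hdK] with i hi
  have := hv _ hi
  rw [add_sub_cancel_left] at this
  have h3 := mul_le_mul_of_nonneg_left this (c i).coe_nonneg
  rw [NNReal.smul_def, inner_smul_right, norm_smul, NNReal.norm_eq]
  linarith

/-- A vector orthogonal to the tangent space and shorter than the reach is realized as a normal
segment. If `p_k` is the nearest point to `a + ε_k • v`, then `(p_k - a) / ε_k` subconverges to some
tangent vector `u`, and Federer's inequality at `p_k` passes to the limit and shows that `v - u` is
normal; so `u = 0` and the inequality holds for `v` itself. -/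
theorem infDist_add_normal {a v : EuclideanSpace ℝ (Fin n)}
    {T : Submodule ℝ (EuclideanSpace ℝ (Fin n))} (haK : a ∈ K)
    (hT : posTangentConeAt K a = (T : Set (EuclideanSpace ℝ (Fin n)))) (hv : v ∈ Tᗮ)
    (hr : ENNReal.ofReal ‖v‖ < reach K) :
    infDist (a + v) K = ‖v‖ := by
  have hK : IsClosed K := isClosed_of_reach_pos (pos_of_gt hr)
  rcases (norm_nonneg v).eq_or_lt with h0 | hvpos
  · rw [norm_eq_zero.1 h0.symm, add_zero, norm_zero]
    exact infDist_zero_of_mem haK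
  have hub : ∀ ε : ℝ, 0 ≤ ε → infDist (a + ε • v) K ≤ ε * ‖v‖ := fun ε hε => by
    refine (infDist_le_dist_of_mem haK).trans ?_
    rw [dist_eq_norm, add_sub_cancel_left, norm_smul, Real.norm_of_nonneg hε]
  -- Nearest points `p k` to `a + ε k • v`, with rescaled displacements `u k` bounded by `2 * ‖v‖`.
  set ε : ℕ → ℝ := fun k => 1 / ((k : ℝ) + 1) with hε
  have hε0 : ∀ k, 0 < ε k := fun k => Nat.one_div_pos_of_nat
  have hε1 : ∀ k, ε k ≤ 1 := fun k => by
    rw [hε]; simp only; rw [div_le_one (by positivity)]; linarith [(Nat.cast_nonneg k : (0:ℝ) ≤ k)]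
  have hεlim : Tendsto ε atTop (𝓝 0) := tendsto_one_div_add_atTop_nhds_zero_nat
  choose p hp using fun k => proj_nonempty hK ⟨a, haK⟩ (a + ε k • v)
  set u : ℕ → EuclideanSpace ℝ (Fin n) := fun k => (ε k)⁻¹ • (p k - a) with hu
  have hpu : ∀ k, p k = a + ε k • u k := fun k => by
    simp only [hu]; rw [smul_smul, mul_inv_cancel₀ (hε0 k).ne', one_smul]; abel
  have hxp : ∀ k, a + ε k • v - p k = ε k • (v - u k) := fun k => by
    rw [hpu k, smul_sub]; abel
  have hvu : ∀ k, ‖v - u k‖ ≤ ‖v‖ := fun k => by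
    have h1 := hub (ε k) (hε0 k).le
    rw [(hp k).2, hxp k, norm_smul, Real.norm_of_nonneg (hε0 k).le] at h1
    exact le_of_mul_le_mul_left h1 (hε0 k)
  have hub' : ∀ k, u k ∈ closedBall v ‖v‖ := fun k => by
    rw [mem_closedBall, dist_comm, dist_eq_norm]; exact hvu k
  obtain ⟨u₀, -, φ, hφ, hulim⟩ := (isCompact_closedBall v ‖v‖).tendsto_subseq hub'
  have hεφ : Tendsto (fun k => ε (φ k)) atTop (𝓝 0) := hεlim.comp hφ.tendsto_atTop
  have hpa : Tendsto (fun k => ε (φ k) • u (φ k)) atTop (𝓝 0) := by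
    simpa using hεφ.smul hulim
  have hu₀T : u₀ ∈ T := by
    rw [← SetLike.mem_coe, ← hT]
    refine mem_tangentConeAt_of_seq atTop (fun k => (ε (φ k))⁻¹.toNNReal)
      (fun k => ε (φ k) • u (φ k)) hpa ?_ ?_
    · exact Eventually.of_forall fun k => by rw [← hpu]; exact (hp _).1
    · refine hulim.congr fun k => ?_
      rw [NNReal.smul_def, Real.coe_toNNReal _ (inv_pos.2 (hε0 _)).le, smul_smul,
        inv_mul_cancel₀ (hε0 (φ k)).ne', one_smul, Function.comp_apply]
  -- Divide the inequality at `p k` by `ε k` and let `k → ∞`.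
  have hlim : ∀ b ∈ K, 2 * ‖v‖ * ⟪v - u₀, b - a⟫ ≤ ‖b - a‖ ^ 2 * ‖v - u₀‖ := by
    intro b hb
    have hba : Tendsto (fun k => b - p (φ k)) atTop (𝓝 (b - a)) := by
      have : Tendsto (fun k => b - (a + ε (φ k) • u (φ k))) atTop (𝓝 (b - (a + 0))) :=
        tendsto_const_nhds.sub (tendsto_const_nhds.add hpa)
      rw [add_zero] at this
      exact this.congr fun k => by rw [← hpu]
    have hvu₀ : Tendsto (fun k => v - u (φ k)) atTop (𝓝 (v - u₀)) := tendsto_const_nhds.sub hulim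
    refine le_of_tendsto_of_tendsto ((hvu₀.inner hba).const_mul (2 * ‖v‖))
      ((hba.norm.pow 2).mul hvu₀.norm) (Eventually.of_forall fun k => ?_)
    have h1 := two_mul_inner_le (r := ‖v‖) (hp (φ k)) hb
      ((hub _ (hε0 _).le).trans (mul_le_of_le_one_left (norm_nonneg v) (hε1 _))) hr
    rw [hxp, real_inner_smul_left, norm_smul, Real.norm_of_nonneg (hε0 _).le] at h1
    refine le_of_mul_le_mul_left ?_ (hε0 (φ k))
    change ε (φ k) * (2 * ‖v‖ * ⟪v - u (φ k), b - p (φ k)⟫) ≤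
      ε (φ k) * (‖b - p (φ k)‖ ^ 2 * ‖v - u (φ k)‖)
    linarith
  -- As `v ⟂ u₀`, the normality of `v - u₀` to the tangent vector `-u₀` reads `‖u₀‖ ^ 2 ≤ 0`.
  have hnonpos : ⟪v - u₀, -u₀⟫ ≤ 0 := by
    refine inner_nonpos_of_mem_posTangentConeAt (K := K) (a := a)
      (C := ‖v - u₀‖ / (2 * ‖v‖)) (fun b hb => ?_) ?_
    · rw [div_mul_eq_mul_div, le_div_iff₀ (by positivity)]
      linarith [hlim b hb]
    · rw [hT]; exact T.neg_mem hu₀T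
  have hu0 : u₀ = 0 := by
    have hvu : ⟪v, u₀⟫ = 0 := (Submodule.mem_orthogonal' T v).1 hv u₀ hu₀T
    rw [inner_neg_right, inner_sub_left, hvu, real_inner_self_eq_norm_sq] at hnonpos
    have : ‖u₀‖ ^ 2 = 0 := le_antisymm (by linarith) (sq_nonneg _)
    exact norm_eq_zero.1 (pow_eq_zero_iff two_ne_zero |>.1 this)
  refine le_antisymm ((hub 1 zero_le_one).trans_eq' (by rw [one_smul]) |>.trans_eq (one_mul _)) ?_
  refine (le_infDist ⟨a, haK⟩).2 fun b hb => ?_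
  have h1 := hlim b hb
  rw [hu0, sub_zero] at h1
  have h2 : 2 * ⟪v, b - a⟫ ≤ ‖b - a‖ ^ 2 := by
    refine le_of_mul_le_mul_right ?_ hvpos; linarith
  rw [dist_eq_norm]
  refine le_of_sq_le_sq ?_ (norm_nonneg _)
  have e : a + v - b = v - (b - a) := by abel
  rw [e, norm_sub_sq_real]; linarith

end Geometry

/-! ### The norm of a standard Gaussian vector -/

section Gaussian

open Filter
open scoped RealInnerProductSpace

open Module

section

variable (V : Type*) [NormedAddCommGroup V] [InnerProductSpace ℝ V]

/-- The density of the standard Gaussian measure with respect to the Lebesgue measure. -/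
noncomputable def gaussianDensity (x : V) : ℝ :=
  ((2 * Real.pi) ^ (finrank ℝ V / 2 : ℝ))⁻¹ * Real.exp (-(1 / 2) * ‖x‖ ^ 2)

variable {V}

theorem gaussianDensity_nonneg (x : V) : 0 ≤ gaussianDensity V x := by
  unfold gaussianDensity; positivity

theorem measurable_gaussianDensity [MeasurableSpace V] [BorelSpace V] :
    Measurable (gaussianDensity V) := by
  unfold gaussianDensity; fun_prop

end

variable {V : Type*} [NormedAddCommGroup V] [InnerProductSpace ℝ V] [FiniteDimensional ℝ V]
  [MeasurableSpace V] [BorelSpace V]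

theorem integrable_exp_neg_mul_sq_norm {b : ℝ} (hb : 0 < b) :
    Integrable fun x : V => Real.exp (-b * ‖x‖ ^ 2) := by
  refine Integrable.of_integral_ne_zero ?_
  rw [GaussianFourier.integral_rexp_neg_mul_sq_norm hb]
  positivity

/-- Both measures have the characteristic function `exp (-‖t‖ ^ 2 / 2)`. -/
theorem stdGaussian_eq_withDensity :
    stdGaussian V = volume.withDensity fun x => ENNReal.ofReal (gaussianDensity V x) := by
  have hint : Integrable (gaussianDensity V) :=
    (integrable_exp_neg_mul_sq_norm (by norm_num)).const_mul _
  have : IsFiniteMeasure (volume.withDensity fun x : V => ENNReal.ofReal (gaussianDensity V x)) :=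
    isFiniteMeasure_withDensity_ofReal hint.2
  refine Measure.ext_of_charFun (funext fun t => ?_)
  rw [charFun_stdGaussian, charFun_apply,
    integral_withDensity_eq_integral_toReal_smul measurable_gaussianDensity.ennreal_ofReal
      (Eventually.of_forall fun _ => ENNReal.ofReal_lt_top)]
  have h := GaussianFourier.integral_cexp_neg_mul_sq_norm_add (V := V) (b := 1 / 2)
    (by norm_num) Complex.I t
  have hc : ((2 * Real.pi : ℝ) : ℂ) ^ (finrank ℝ V / 2 : ℂ) ≠ 0 := by
    rw [Complex.cpow_ne_zero_iff]
    left
    exact_mod_cast Real.two_pi_pos.ne'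
  have e : ∀ x : V, (ENNReal.ofReal (gaussianDensity V x)).toReal •
      Complex.exp (⟪x, t⟫ * Complex.I) = (((2 * Real.pi : ℝ) : ℂ) ^ (finrank ℝ V / 2 : ℂ))⁻¹ *
        Complex.exp (-(1 / 2) * ‖x‖ ^ 2 + Complex.I * ⟪t, x⟫) := fun x => by
    rw [ENNReal.toReal_ofReal (gaussianDensity_nonneg x), Complex.real_smul, gaussianDensity,
      Complex.exp_add, real_inner_comm x t, mul_comm Complex.I]
    push_cast
    rw [Complex.ofReal_cpow (by positivity)]
    push_cast
    ring
  simp_rw [e]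
  rw [integral_const_mul, h]
  have e2 : (Real.pi / (1 / 2) : ℂ) = ((2 * Real.pi : ℝ) : ℂ) := by push_cast; ring
  rw [e2, inv_mul_cancel_left₀ hc, Complex.I_sq]
  congr 1; ring

variable (V) in
theorem integrable_exp_sq_norm_stdGaussian {b : ℝ} (hb : 0 < b) :
    Integrable (fun x : V => Real.exp ((1 - b ^ 2) / 2 * ‖x‖ ^ 2)) (stdGaussian V) := by
  rw [stdGaussian_eq_withDensity, integrable_withDensity_iff_integrable_smul'
    measurable_gaussianDensity.ennreal_ofReal (Eventually.of_forall fun _ => ENNReal.ofReal_lt_top)]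
  refine ((integrable_exp_neg_mul_sq_norm (V := V) (b := b ^ 2 / 2) (by positivity)).const_mul
    ((2 * Real.pi) ^ (finrank ℝ V / 2 : ℝ))⁻¹).congr (Eventually.of_forall fun x => ?_)
  simp only
  rw [ENNReal.toReal_ofReal (gaussianDensity_nonneg x), gaussianDensity, smul_eq_mul, mul_assoc,
    ← Real.exp_add]
  congr 2; ring

variable (V) in
/-- The moment generating function of `‖x‖ ^ 2` at `λ < 1 / 2`, written with `b = √(1 - 2 * λ)` so that
its value `(1 - 2 * λ) ^ (-m / 2)` is a natural power. -/
theorem integral_exp_sq_norm_stdGaussian {b : ℝ} (hb : 0 < b) :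
    ∫ x : V, Real.exp ((1 - b ^ 2) / 2 * ‖x‖ ^ 2) ∂stdGaussian V = b⁻¹ ^ finrank ℝ V := by
  rw [stdGaussian_eq_withDensity, integral_withDensity_eq_integral_toReal_smul
    measurable_gaussianDensity.ennreal_ofReal (Eventually.of_forall fun _ => ENNReal.ofReal_lt_top)]
  have e : ∀ x : V, (ENNReal.ofReal (gaussianDensity V x)).toReal •
      Real.exp ((1 - b ^ 2) / 2 * ‖x‖ ^ 2) = ((2 * Real.pi) ^ (finrank ℝ V / 2 : ℝ))⁻¹ *
        Real.exp (-(b ^ 2 / 2) * ‖x‖ ^ 2) := fun x => by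
    rw [ENNReal.toReal_ofReal (gaussianDensity_nonneg x), gaussianDensity, smul_eq_mul, mul_assoc,
      ← Real.exp_add]
    congr 2; ring
  simp_rw [e]
  rw [integral_const_mul, GaussianFourier.integral_rexp_neg_mul_sq_norm (by positivity)]
  have e2 : Real.pi / (b ^ 2 / 2) = 2 * Real.pi * (b⁻¹) ^ 2 := by field_simp
  rw [e2, Real.mul_rpow (x := 2 * Real.pi) (by positivity) (by positivity),
    inv_mul_cancel_left₀ (by positivity), ← Real.rpow_natCast_mul (by positivity),
    ← Real.rpow_natCast]
  congr 1; push_cast; ring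

/-- The Chernoff estimate behind both tail bounds for the norm of a standard Gaussian vector: at the
threshold `√m + s`, of either sign of `s`, the best parameter is the one with
`b = √m / (√m + s)`. -/
theorem chernoff_le {m : ℕ} (hm : 0 < m) {s : ℝ} (hs : 0 < √m + s) :
    Real.exp (-((1 - (√m / (√m + s)) ^ 2) / 2) * (√m + s) ^ 2) * (√m / (√m + s))⁻¹ ^ m ≤
      Real.exp (-s ^ 2 / 2) := by
  have hm' : 0 < √(m : ℝ) := Real.sqrt_pos.2 (by exact_mod_cast hm)
  have hsq : √(m : ℝ) ^ 2 = m := Real.sq_sqrt (Nat.cast_nonneg m)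
  have h1 : (√m / (√m + s))⁻¹ ^ m ≤ Real.exp (√m * s) := by
    have h2 : (√m / (√m + s))⁻¹ ≤ Real.exp (s / √m) := by
      have := Real.add_one_le_exp (s / √(m : ℝ))
      refine le_trans (le_of_eq ?_) this
      field_simp
      ring
    calc (√m / (√m + s))⁻¹ ^ m ≤ Real.exp (s / √m) ^ m := by gcongr
      _ = Real.exp (√m * s) := by
        rw [← Real.exp_nat_mul]; congr 1; nth_rw 1 [← hsq]; field_simp
  calc _ ≤ Real.exp (-((1 - (√m / (√m + s)) ^ 2) / 2) * (√m + s) ^ 2) * Real.exp (√m * s) := by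
        gcongr
    _ = _ := by
        rw [← Real.exp_add]; congr 1; field_simp; linarith

theorem stdGaussian_real_add_le_norm {t : ℝ} (ht : 0 < t) :
    (stdGaussian V).real {x | √(finrank ℝ V) + t ≤ ‖x‖} ≤ Real.exp (-t ^ 2 / 2) := by
  rcases (finrank ℝ V).eq_zero_or_pos with h0 | hpos
  · have := finrank_zero_iff.1 h0
    have : {x : V | √(finrank ℝ V) + t ≤ ‖x‖} = ∅ := by
      ext x
      simp [h0, Subsingleton.elim x 0, ht]
    rw [this, measureReal_empty]; positivity
  have hm' : 0 < √(finrank ℝ V : ℝ) := Real.sqrt_pos.2 (by exact_mod_cast hpos)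
  set m := finrank ℝ V with hm
  set b := √(m : ℝ) / (√m + t) with hb
  have hb0 : 0 < b := by positivity
  have hb1 : b ≤ 1 := by rw [hb, div_le_one (by positivity)]; linarith
  have hl : 0 ≤ (1 - b ^ 2) / 2 := by nlinarith
  have h := measure_ge_le_exp_mul_mgf (μ := stdGaussian V) (X := fun x : V => ‖x‖ ^ 2)
    ((√m + t) ^ 2) hl (integrable_exp_sq_norm_stdGaussian V hb0)
  rw [mgf, integral_exp_sq_norm_stdGaussian V hb0] at h
  refine (measureReal_mono fun x hx => ?_).trans (h.trans (chernoff_le hpos (by positivity)))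
  have hx : √m + t ≤ ‖x‖ := hx
  change (√m + t) ^ 2 ≤ ‖x‖ ^ 2
  gcongr

theorem stdGaussian_real_norm_le_sub {t : ℝ} (ht : 0 < t) (htm : t < √(finrank ℝ V)) :
    (stdGaussian V).real {x | ‖x‖ ≤ √(finrank ℝ V) - t} ≤ Real.exp (-t ^ 2 / 2) := by
  have hpos : 0 < finrank ℝ V := by
    have := Real.sqrt_pos.1 (ht.trans htm); exact_mod_cast this
  set m := finrank ℝ V with hm
  set b := √(m : ℝ) / (√m + -t) with hb
  have hd : 0 < √(m : ℝ) + -t := by linarith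
  have hb0 : 0 < b := div_pos (by linarith) hd
  have hb1 : 1 ≤ b := by rw [hb, one_le_div hd]; linarith
  have hl : (1 - b ^ 2) / 2 ≤ 0 := by nlinarith
  have h := measure_le_le_exp_mul_mgf (μ := stdGaussian V) (X := fun x : V => ‖x‖ ^ 2)
    ((√m + -t) ^ 2) hl (integrable_exp_sq_norm_stdGaussian V hb0)
  rw [mgf, integral_exp_sq_norm_stdGaussian V hb0] at h
  refine (measureReal_mono fun x hx => ?_).trans (h.trans ((chernoff_le hpos hd).trans_eq ?_))
  · have hx : ‖x‖ ≤ √m + -t := hx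
    change ‖x‖ ^ 2 ≤ (√m + -t) ^ 2
    gcongr
  · rw [neg_sq]

theorem add_sq_div_two_le_neg_log {x : ℝ} (hx : 0 ≤ x) (hx1 : x < 1) :
    x + x ^ 2 / 2 ≤ -Real.log (1 - x) := by
  have h := Real.hasSum_pow_div_log_of_abs_lt_one (x := x) (by rwa [abs_of_nonneg hx])
  have := sum_le_hasSum (Finset.range 2) (fun i _ => by positivity) h
  norm_num [Finset.sum_range_succ] at this
  exact this

theorem neg_log_le_add_sq {x : ℝ} (hx1 : x ≤ 1 / 2) :
    -Real.log (1 - x) ≤ x + 2 * x ^ 2 := by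
  have h := Real.one_sub_inv_le_log_of_pos (x := 1 - x) (by linarith)
  have h2 : (1 - x)⁻¹ ≤ 1 + x + 2 * x ^ 2 := by
    rw [inv_le_iff_one_le_mul₀ (by linarith)]
    nlinarith [sq_nonneg x, mul_nonneg (sq_nonneg x) (by linarith : 0 ≤ 1 - 2 * x)]
  linarith

/-- The moment generating function of `‖x‖ ^ 2 - m`, as an exponential. -/
theorem integral_exp_centered_sq_norm {x : ℝ} (hx : x < 1) :
    ∫ y : V, Real.exp (x / 2 * (‖y‖ ^ 2 - finrank ℝ V)) ∂stdGaussian V =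
      Real.exp (finrank ℝ V / 2 * (-Real.log (1 - x) - x)) := by
  have hb : 0 < √(1 - x) := Real.sqrt_pos.2 (by linarith)
  have e : ∀ y : V, Real.exp (x / 2 * (‖y‖ ^ 2 - finrank ℝ V)) =
      Real.exp (-(x / 2 * finrank ℝ V)) * Real.exp ((1 - √(1 - x) ^ 2) / 2 * ‖y‖ ^ 2) := fun y => by
    rw [← Real.exp_add, Real.sq_sqrt (by linarith)]; congr 1; ring
  simp_rw [e]
  rw [integral_const_mul, integral_exp_sq_norm_stdGaussian V hb]
  have e2 : (√(1 - x))⁻¹ = Real.exp (-(Real.log (1 - x) / 2)) := by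
    rw [← Real.log_sqrt (by linarith), Real.exp_neg, Real.exp_log hb]
  rw [e2, ← Real.exp_nat_mul, ← Real.exp_add]
  congr 1; ring

theorem integrable_exp_centered_sq_norm {x : ℝ} (hx : x < 1) :
    Integrable (fun y : V => Real.exp (x / 2 * (‖y‖ ^ 2 - finrank ℝ V))) (stdGaussian V) := by
  refine Integrable.of_integral_ne_zero ?_
  rw [integral_exp_centered_sq_norm hx]
  exact (Real.exp_pos _).ne'

/-- The norm of a standard Gaussian vector exceeds the square root of the dimension with probability
bounded below. With `f = exp (λ (‖x‖ ^ 2 - m))`, the mean of `f` exceeds `1` by a constant, while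
`f ≤ 1` where `‖x‖ ^ 2 < m`; so the set `‖x‖ ^ 2 ≥ m` carries a constant share, and the second moment
of `f` prevents that share from sitting on a small set. -/
theorem le_stdGaussian_real_sqrt_le_norm (hV : 0 < finrank ℝ V) :
    1 / 8192 ≤ (stdGaussian V).real {x | √(finrank ℝ V) ≤ ‖x‖} := by
  set m := finrank ℝ V with hm
  have hm1 : (1 : ℝ) ≤ √m := Real.one_le_sqrt.2 (by exact_mod_cast hV)
  have hm0 : 0 < √(m : ℝ) := by linarith
  have hsq : √(m : ℝ) ^ 2 = m := Real.sq_sqrt (Nat.cast_nonneg m)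
  -- The parameter is of order `1 / √m`, so that the mean and the second moment of `f` do not depend
  -- on the dimension up to constants.
  set x : ℝ := 1 / (4 * √m) with hx
  have hx0 : 0 < x := by positivity
  have hx1 : x ≤ 1 / 4 := by
    rw [hx]; gcongr; linarith
  have hmx : m * x ^ 2 = 1 / 16 := by rw [← hsq, hx]; field_simp; norm_num
  set f : V → ℝ := fun y => Real.exp (x / 2 * (‖y‖ ^ 2 - m)) with hf
  have hfint : Integrable f (stdGaussian V) := integrable_exp_centered_sq_norm (by linarith)
  have hf2 : ∀ y, f y ^ 2 = Real.exp (2 * x / 2 * (‖y‖ ^ 2 - m)) := fun y => by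
    rw [hf, ← Real.exp_nat_mul]; congr 1; push_cast; ring
  have hf2int : Integrable (fun y => f y ^ 2) (stdGaussian V) := by
    simp_rw [hf2]; exact integrable_exp_centered_sq_norm (by linarith)
  have hA : 1 + 1 / 64 ≤ ∫ y, f y ∂stdGaussian V := by
    rw [hf, integral_exp_centered_sq_norm (by linarith)]
    have h1 := add_sq_div_two_le_neg_log hx0.le (by linarith)
    have h2 : (1 / 64 : ℝ) ≤ m / 2 * (-Real.log (1 - x) - x) :=
      calc (1 / 64 : ℝ) = m / 2 * (x ^ 2 / 2) := by linarith
        _ ≤ _ := by gcongr; linarith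
    linarith [Real.add_one_le_exp (m / 2 * (-Real.log (1 - x) - x))]
  have hB : ∫ y, f y ^ 2 ∂stdGaussian V ≤ 2 := by
    simp_rw [hf2]
    rw [integral_exp_centered_sq_norm (by linarith)]
    have h1 := neg_log_le_add_sq (x := 2 * x) (by linarith)
    have h2 : m / 2 * (-Real.log (1 - 2 * x) - 2 * x) ≤ 1 / 4 :=
      calc m / 2 * (-Real.log (1 - 2 * x) - 2 * x) ≤ m / 2 * (8 * x ^ 2) := by
            gcongr; linarith
        _ = 1 / 4 := by linarith
    refine (Real.exp_le_exp.2 h2).trans ?_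
    have := Real.one_sub_div_pow_le_exp_neg (n := 1) (t := 1 / 4) (by norm_num)
    rw [Real.exp_neg] at this
    have h3 := Real.exp_pos (1 / 4)
    rw [pow_one, le_inv_comm₀ (by norm_num) h3] at this
    exact this.trans (by norm_num)
  set S : Set V := {y | √m ≤ ‖y‖} with hS
  have hSm : MeasurableSet S := measurableSet_le measurable_const measurable_norm
  -- On `S`, `f ≤ f ^ 2 / 256 + 64`. The coefficient `1 / 256` makes the second moment, at most `2`,
  -- contribute half of the gain `1 / 64`; the other half must come from `64 * P(S)`.
  have hpt : ∀ y, f y ≤ 1 + 1 / 256 * f y ^ 2 + S.indicator (fun _ => (64 : ℝ)) y := fun y => by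
    by_cases hy : y ∈ S
    · rw [Set.indicator_of_mem hy]
      nlinarith [sq_nonneg (f y - 128)]
    · rw [Set.indicator_of_notMem hy]
      have hy' : ‖y‖ < √m := not_le.1 hy
      have h1 : ‖y‖ ^ 2 ≤ m := by rw [← hsq]; gcongr
      have : f y ≤ 1 := Real.exp_le_one_iff.2
        (mul_nonpos_of_nonneg_of_nonpos (by positivity) (by linarith))
      nlinarith [sq_nonneg (f y)]
  have hI := integral_mono (μ := stdGaussian V) hfint
    (((integrable_const (1 : ℝ)).add (hf2int.const_mul (1 / 256))).add
      ((integrable_const (64 : ℝ)).indicator hSm)) hpt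
  rw [integral_add' ((integrable_const (1 : ℝ)).add (hf2int.const_mul (1 / 256)))
      ((integrable_const (64 : ℝ)).indicator hSm),
    integral_add' (integrable_const (1 : ℝ)) (hf2int.const_mul (1 / 256)),
    integral_const_mul, integral_indicator_const _ hSm] at hI
  simp only [integral_const, probReal_univ, smul_eq_mul, mul_one] at hI
  linarith

/-- Outside the ball of radius `√m`, dilations decrease the standard Gaussian measure. -/
theorem stdGaussian_preimage_inv_smul_le {c : ℝ} (hc : 1 ≤ c) {A : Set V} (hA : MeasurableSet A)
    (hAm : ∀ x ∈ A, √(finrank ℝ V) ≤ ‖x‖) :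
    stdGaussian V ((c⁻¹ • ·) ⁻¹' A) ≤ stdGaussian V A := by
  have hc0 : 0 < c := by linarith
  have hmeas : Measurable fun x : V => c⁻¹ • x := measurable_const_smul _
  set ρ : V → ℝ≥0∞ := fun x => ENNReal.ofReal (gaussianDensity V x) with hρ
  have hρm : Measurable ρ := measurable_gaussianDensity.ennreal_ofReal
  rw [stdGaussian_eq_withDensity, withDensity_apply _ (hmeas hA), withDensity_apply _ hA,
    ← lintegral_indicator (hmeas hA), ← lintegral_indicator hA]
  have e : ∀ x : V, ((c⁻¹ • ·) ⁻¹' A).indicator ρ x =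
      (A.indicator fun y => ρ (c • y)) (c⁻¹ • x) := fun x => by
    by_cases hx : c⁻¹ • x ∈ A
    · rw [Set.indicator_of_mem (by exact hx), Set.indicator_of_mem hx, smul_inv_smul₀ hc0.ne']
    · rw [Set.indicator_of_notMem (by exact hx), Set.indicator_of_notMem hx]
  have hind : Measurable (A.indicator fun y => ρ (c • y)) :=
    (hρm.comp (measurable_const_smul c)).indicator hA
  rw [lintegral_congr e, ← lintegral_map (f := A.indicator fun y => ρ (c • y)) hind hmeas,
    Measure.map_addHaar_smul _ (inv_pos.2 hc0).ne', lintegral_smul_measure, smul_eq_mul,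
    ← lintegral_const_mul _ hind]
  refine lintegral_mono fun y => ?_
  by_cases hy : y ∈ A
  · simp only [Set.indicator_of_mem hy]
    rw [hρ, ← ENNReal.ofReal_mul (abs_nonneg _)]
    refine ENNReal.ofReal_le_ofReal ?_
    rw [inv_pow, inv_inv, abs_of_pos (by positivity), gaussianDensity, gaussianDensity, norm_smul,
      Real.norm_of_nonneg hc0.le, mul_left_comm]
    refine mul_le_mul_of_nonneg_left ?_ (by positivity)
    have h1 : c ≤ Real.exp ((c ^ 2 - 1) / 2) := by
      refine le_trans ?_ (Real.add_one_le_exp _)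
      nlinarith [sq_nonneg (c - 1)]
    have h2 : (finrank ℝ V : ℝ) ≤ ‖y‖ ^ 2 := by
      rw [← Real.sq_sqrt (Nat.cast_nonneg (finrank ℝ V))]
      have := hAm y hy
      gcongr
    calc c ^ finrank ℝ V * Real.exp (-(1 / 2) * (c * ‖y‖) ^ 2)
        ≤ Real.exp ((c ^ 2 - 1) / 2) ^ finrank ℝ V * Real.exp (-(1 / 2) * (c * ‖y‖) ^ 2) := by
          gcongr
      _ = Real.exp (finrank ℝ V * ((c ^ 2 - 1) / 2) + -(1 / 2) * (c * ‖y‖) ^ 2) := by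
          rw [← Real.exp_nat_mul, ← Real.exp_add]
      _ ≤ _ := by
          refine Real.exp_le_exp.2 ?_
          have h3 : 0 ≤ (c ^ 2 - 1) / 2 := by nlinarith
          have := mul_le_mul_of_nonneg_right h2 h3
          linarith
  · simp [Set.indicator_of_notMem hy]

/-- The annulus between the radii `√m` and `√m * c ^ N` is covered by `N` dilates of the
innermost one. -/
theorem stdGaussian_annulus_le {c : ℝ} (hc : 1 ≤ c) (N : ℕ) :
    stdGaussian V {x | √(finrank ℝ V) ≤ ‖x‖ ∧ ‖x‖ < √(finrank ℝ V) * c ^ N} ≤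
      N * stdGaussian V {x | √(finrank ℝ V) ≤ ‖x‖ ∧ ‖x‖ < √(finrank ℝ V) * c} := by
  set r := √(finrank ℝ V : ℝ) with hr
  set A : Set V := {x | r ≤ ‖x‖ ∧ ‖x‖ < r * c} with hA
  have hAm : MeasurableSet A := (measurableSet_le measurable_const measurable_norm).inter
    (measurableSet_lt measurable_norm measurable_const)
  have hc0 : 0 < c := by linarith
  induction N with
  | zero =>
    have : {x : V | r ≤ ‖x‖ ∧ ‖x‖ < r * c ^ 0} = ∅ := by
      ext x
      simp
    rw [this, measure_empty]
    exact zero_le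
  | succ N ih =>
    have hcN : 1 ≤ c ^ N := one_le_pow₀ hc
    have hcN0 : 0 < c ^ N := by positivity
    have hsub : {x : V | r ≤ ‖x‖ ∧ ‖x‖ < r * c ^ (N + 1)} ⊆
        {x | r ≤ ‖x‖ ∧ ‖x‖ < r * c ^ N} ∪ (((c ^ N)⁻¹ • ·) ⁻¹' A) := by
      rintro x ⟨h1, h2⟩
      by_cases h : ‖x‖ < r * c ^ N
      · exact Or.inl ⟨h1, h⟩
      · right
        change r ≤ ‖(c ^ N)⁻¹ • x‖ ∧ ‖(c ^ N)⁻¹ • x‖ < r * c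
        rw [norm_smul, norm_inv, Real.norm_of_nonneg hcN0.le, inv_mul_eq_div,
          le_div_iff₀ hcN0, div_lt_iff₀ hcN0]
        exact ⟨not_lt.1 h, h2.trans_eq (by ring)⟩
    refine (measure_mono hsub).trans ((measure_union_le _ _).trans ?_)
    rw [Nat.cast_succ, add_mul, one_mul]
    exact add_le_add ih (stdGaussian_preimage_inv_smul_le hcN hAm fun x hx => hx.1)

/-- Small annuli around the sphere of radius `√m` have measure at least proportional to their
width. -/
theorem le_stdGaussian_real_annulus (hV : 0 < finrank ℝ V) {t : ℝ} (ht : 0 < t) (ht5 : t ≤ 5) :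
    t / 163840 ≤ (stdGaussian V).real
      {x | √(finrank ℝ V) ≤ ‖x‖ ∧ ‖x‖ < √(finrank ℝ V) + t} := by
  set r := √(finrank ℝ V : ℝ) with hr
  have hr0 : 0 < r := Real.sqrt_pos.2 (by exact_mod_cast hV)
  set N := ⌈5 / t⌉₊ with hN
  have hN5 : 5 ≤ N * t := by
    rw [← div_le_iff₀ ht]; exact Nat.le_ceil _
  have hN10 : N * t ≤ 10 := by
    have := (Nat.ceil_lt_add_one (a := 5 / t) (by positivity)).le
    calc N * t ≤ (5 / t + 1) * t := by gcongr
      _ = 5 + t := by field_simp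
      _ ≤ 10 := by linarith
  have hc : 1 ≤ 1 + t / r := by linarith [div_pos ht hr0]
  have hrc : r * (1 + t / r) = r + t := by field_simp
  have hcov := stdGaussian_annulus_le (V := V) hc N
  rw [← hr, hrc] at hcov
  have hcov' := ENNReal.toReal_mono (by finiteness) hcov
  rw [ENNReal.toReal_mul, ENNReal.toReal_natCast] at hcov'
  have hpow : r + 5 ≤ r * (1 + t / r) ^ N := by
    have h1 := one_add_mul_le_pow (a := t / r) (by linarith [div_pos ht hr0]) N
    calc r + 5 ≤ r + N * t := by linarith
      _ = r * (1 + N * (t / r)) := by field_simp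
      _ ≤ _ := by gcongr
  have hsub : {x : V | r ≤ ‖x‖} ⊆
      {x | r ≤ ‖x‖ ∧ ‖x‖ < r * (1 + t / r) ^ N} ∪ {x | r + 5 ≤ ‖x‖} := fun x hx => by
    by_cases h : ‖x‖ < r * (1 + t / r) ^ N
    · exact Or.inl ⟨hx, h⟩
    · exact Or.inr (hpow.trans (not_lt.1 h))
  have h1 := le_stdGaussian_real_sqrt_le_norm hV
  have h2 := (measureReal_mono hsub).trans (measureReal_union_le (μ := stdGaussian V) _ _)
  have h3 := stdGaussian_real_add_le_norm (V := V) (t := 5) (by norm_num)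
  -- The width `5` makes the mass beyond the wide annulus at most half of `1 / 8192`.
  have h4 : Real.exp (-5 ^ 2 / 2) ≤ 1 / 16384 := by
    have h5 : (2.7 : ℝ) ≤ Real.exp 1 := by linarith [Real.exp_one_gt_d9]
    calc Real.exp (-5 ^ 2 / 2) ≤ Real.exp (-12) := Real.exp_le_exp.2 (by norm_num)
      _ = (Real.exp 1 ^ 12)⁻¹ := by rw [← Real.exp_nat_mul, ← Real.exp_neg]; norm_num
      _ ≤ (2.7 ^ 12)⁻¹ := by gcongr
      _ ≤ 1 / 16384 := by norm_num
  rw [← hr] at h1 h3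
  change (stdGaussian V).real _ ≤ N * (stdGaussian V).real _ at hcov'
  set P := (stdGaussian V).real {x | r ≤ ‖x‖ ∧ ‖x‖ < r + t} with hP
  have hP0 : 0 ≤ P := measureReal_nonneg
  have h7 : 1 / 16384 ≤ N * P := by linarith
  have h8 : N * t * P ≤ 10 * P := by gcongr
  nlinarith

/-- Concentration of the norm around `√m`, without a constant in front of the exponential: for
large `t` it follows from the two tail bounds, for small `t` from the lower bound on annuli. -/
theorem le_stdGaussian_real_abs_norm_sub_lt {t : ℝ} (ht : 0 < t) (htm : t < √(finrank ℝ V)) :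
    1 - Real.exp (-(1 / 1000000) * t ^ 2) ≤ (stdGaussian V).real
      {x | √(finrank ℝ V) - t ≤ ‖x‖ ∧ ‖x‖ ≤ √(finrank ℝ V) + t} := by
  have hpos : 0 < finrank ℝ V := by
    have := Real.sqrt_pos.1 (ht.trans htm); exact_mod_cast this
  rcases le_total t 5 with h5 | h5
  · refine le_trans ?_ ((le_stdGaussian_real_annulus hpos ht h5).trans
      (measureReal_mono fun x hx => ⟨by linarith [hx.1], hx.2.le⟩))
    -- It remains to see that `t ^ 2 / 1000000 ≤ t / 163840`, which holds as `t ≤ 5`.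
    have := Real.add_one_le_exp (-(1 / 1000000) * t ^ 2)
    nlinarith
  · have hsub : (Set.univ : Set V) ⊆ {x | √(finrank ℝ V) - t ≤ ‖x‖ ∧ ‖x‖ ≤ √(finrank ℝ V) + t} ∪
        ({x | √(finrank ℝ V) + t ≤ ‖x‖} ∪ {x | ‖x‖ ≤ √(finrank ℝ V) - t}) := fun x _ => by
      rcases le_total (√(finrank ℝ V) + t) ‖x‖ with h | h
      · exact Or.inr (Or.inl h)
      rcases le_total (√(finrank ℝ V) - t) ‖x‖ with h' | h'
      · exact Or.inl ⟨h', h⟩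
      · exact Or.inr (Or.inr h')
    have h1 := (measureReal_mono hsub).trans (measureReal_union_le (μ := stdGaussian V) _ _)
    have h2 := measureReal_union_le (μ := stdGaussian V)
      {x | √(finrank ℝ V) + t ≤ ‖x‖} {x | ‖x‖ ≤ √(finrank ℝ V) - t}
    have h3 := stdGaussian_real_add_le_norm (V := V) ht
    have h4 := stdGaussian_real_norm_le_sub (V := V) ht htm
    rw [probReal_univ] at h1
    have h6 : 2 * Real.exp (-t ^ 2 / 2) ≤ Real.exp (-(1 / 1000000) * t ^ 2) := by
      have h7 : 2 ≤ Real.exp 1 := by linarith [Real.add_one_le_exp 1]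
      calc 2 * Real.exp (-t ^ 2 / 2) ≤ Real.exp 1 * Real.exp (-t ^ 2 / 2) := by gcongr
        _ = Real.exp (1 + -t ^ 2 / 2) := (Real.exp_add _ _).symm
        _ ≤ _ := Real.exp_le_exp.2 (by nlinarith)
    linarith

end Gaussian

/-! ### Tangential and normal components of a standard Gaussian vector -/

section Decomposition

open scoped RealInnerProductSpace

open Module

variable {V : Type*} [NormedAddCommGroup V] [InnerProductSpace ℝ V] [FiniteDimensional ℝ V]
  [MeasurableSpace V] [BorelSpace V]

/-- The components of a standard Gaussian vector in a subspace and in its orthogonal complement are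
independent standard Gaussian vectors. -/
theorem stdGaussian_eq_map_add (T : Submodule ℝ V) :
    stdGaussian V = ((stdGaussian T).prod (stdGaussian Tᗮ)).map
      fun z : T × Tᗮ => (z.1 : V) + (z.2 : V) := by
  have hm : Measurable fun z : T × Tᗮ => (z.1 : V) + (z.2 : V) := by fun_prop
  have := Measure.isProbabilityMeasure_map (μ := (stdGaussian T).prod (stdGaussian Tᗮ))
    hm.aemeasurable
  refine Measure.ext_of_charFun (funext fun t => ?_)
  rw [charFun_apply (μ := Measure.map _ _), integral_map hm.aemeasurable (by fun_prop)]
  have e : ∀ z : T × Tᗮ, Complex.exp (⟪(z.1 : V) + (z.2 : V), t⟫ * Complex.I) =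
      Complex.exp (⟪z.1, T.orthogonalProjectionOnto t⟫ * Complex.I) *
        Complex.exp (⟪z.2, Tᗮ.orthogonalProjectionOnto t⟫ * Complex.I) := fun z => by
    rw [← Complex.exp_add, ← add_mul, ← Complex.ofReal_add, inner_add_left]
    simp
  simp_rw [e]
  rw [integral_prod_mul (fun z : T => Complex.exp (⟪z, T.orthogonalProjectionOnto t⟫ * Complex.I))
    (fun z : Tᗮ => Complex.exp (⟪z, Tᗮ.orthogonalProjectionOnto t⟫ * Complex.I)),
    ← charFun_apply, ← charFun_apply, charFun_stdGaussian, charFun_stdGaussian,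
    charFun_stdGaussian, ← Complex.exp_add]
  congr 1
  have h := T.norm_sq_eq_add_norm_sq_projection t
  rw [← Complex.ofReal_pow, ← Complex.ofReal_pow, ← Complex.ofReal_pow, h]
  push_cast; ring

theorem stdGaussian_projection_mem (T : Submodule ℝ V) {A : Set T} {B : Set Tᗮ}
    (hA : MeasurableSet A) (hB : MeasurableSet B) :
    stdGaussian V {x | T.orthogonalProjectionOnto x ∈ A ∧ Tᗮ.orthogonalProjectionOnto x ∈ B} =
      stdGaussian T A * stdGaussian Tᗮ B := by
  rw [stdGaussian_eq_map_add T, Measure.map_apply (by fun_prop), ← Measure.prod_prod]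
  · congr 1
    ext z
    have h1 : T.orthogonalProjectionOnto (z.2 : V) = 0 :=
      T.orthogonalProjectionOnto_apply_of_mem_orthogonal z.2.2
    have h2 : Tᗮ.orthogonalProjectionOnto (z.1 : V) = 0 :=
      Tᗮ.orthogonalProjectionOnto_apply_of_mem_orthogonal (T.le_orthogonal_orthogonal z.1.2)
    simp [h1, h2]
  · exact (T.orthogonalProjectionOnto.continuous.measurable hA).inter
      (Tᗮ.orthogonalProjectionOnto.continuous.measurable hB)

theorem le_stdGaussian_norm_projection (T : Submodule ℝ V) {t : ℝ} (ht : 0 < t)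
    (htT : t < √(finrank ℝ Tᗮ)) :
    ENNReal.ofReal ((1 - Real.exp (-(1 / 1000000) * t ^ 2)) ^ 2) ≤ stdGaussian V
      {x | ‖T.orthogonalProjectionOnto x‖ ≤ √(finrank ℝ T) + t ∧
        √(finrank ℝ Tᗮ) - t ≤ ‖Tᗮ.orthogonalProjectionOnto x‖ ∧
        ‖Tᗮ.orthogonalProjectionOnto x‖ ≤ √(finrank ℝ Tᗮ) + t} := by
  have hA : MeasurableSet {z : T | ‖z‖ ≤ √(finrank ℝ T) + t} :=
    measurableSet_le measurable_norm measurable_const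
  have hB : MeasurableSet {z : Tᗮ | √(finrank ℝ Tᗮ) - t ≤ ‖z‖ ∧ ‖z‖ ≤ √(finrank ℝ Tᗮ) + t} :=
    (measurableSet_le measurable_const measurable_norm).inter
      (measurableSet_le measurable_norm measurable_const)
  refine le_trans ?_ (stdGaussian_projection_mem T hA hB).ge
  have h0 : 0 ≤ 1 - Real.exp (-(1 / 1000000) * t ^ 2) := by
    rw [sub_nonneg, Real.exp_le_one_iff]; nlinarith
  rw [sq, ENNReal.ofReal_mul h0]
  refine mul_le_mul' ?_ ?_
  · refine ENNReal.ofReal_le_of_le_toReal ?_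
    have h1 := stdGaussian_real_add_le_norm (V := T) ht
    have hsub : (Set.univ : Set T) ⊆ {z : T | ‖z‖ ≤ √(finrank ℝ T) + t} ∪
        {z | √(finrank ℝ T) + t ≤ ‖z‖} := fun z _ =>
      le_total ‖z‖ (√(finrank ℝ T) + t)
    have h2 := (measureReal_mono hsub).trans (measureReal_union_le (μ := stdGaussian T) _ _)
    rw [probReal_univ] at h2
    have h3 : Real.exp (-t ^ 2 / 2) ≤ Real.exp (-(1 / 1000000) * t ^ 2) :=
      Real.exp_le_exp.2 (by nlinarith)
    change _ ≤ (stdGaussian T).real _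
    linarith
  · exact ENNReal.ofReal_le_of_le_toReal (le_stdGaussian_real_abs_norm_sub_lt ht htT)

end Decomposition

/-! ### Projection of a perturbed point -/

section Tube

open Metric

variable {n : ℕ} {K : Set (EuclideanSpace ℝ (Fin n))}

/-- The deterministic part of the result: a displacement `v` from `x₀ ∈ K` with tangential part of
norm at most `a` and normal part of norm at least `b > a`. The base point `x₀` is the nearest point
to `x₀ + (normal part)`; the lower bound on the distance and the bound on the projection come from
comparing `x₀ + v` with that point. -/
theorem projection_bounds {x₀ v : EuclideanSpace ℝ (Fin n)}
    {T : Submodule ℝ (EuclideanSpace ℝ (Fin n))} {a b c : ℝ} (hx₀ : x₀ ∈ K)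
    (hT : posTangentConeAt K x₀ = (T : Set (EuclideanSpace ℝ (Fin n))))
    (hreach : ENNReal.ofReal √(a ^ 2 + c ^ 2) < reach K)
    (ha : ‖T.orthogonalProjectionOnto v‖ ≤ a) (hb : b ≤ ‖Tᗮ.orthogonalProjectionOnto v‖)
    (hc : ‖Tᗮ.orthogonalProjectionOnto v‖ ≤ c) (hab : 0 < b - a) :
    b - a ≤ infDist (x₀ + v) K ∧ infDist (x₀ + v) K ≤ c + a ∧
      ∃ p, proj K (x₀ + v) = {p} ∧
        ‖p - x₀‖ ≤ reachFactor (reach K) √(a ^ 2 + c ^ 2) * a / (b - a) * infDist (x₀ + v) K := by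
  set h := √(a ^ 2 + c ^ 2) with hh
  set u : EuclideanSpace ℝ (Fin n) := (T.orthogonalProjectionOnto v : EuclideanSpace ℝ (Fin n))
    with hu
  set w : EuclideanSpace ℝ (Fin n) := (Tᗮ.orthogonalProjectionOnto v : EuclideanSpace ℝ (Fin n))
    with hw
  have huw : u + w = v := by
    exact T.starProjection_add_starProjection_orthogonal v
  have hun : ‖u‖ ≤ a := ha
  have hwn : b ≤ ‖w‖ := hb
  have hwc : ‖w‖ ≤ c := hc
  have ha0 : 0 ≤ a := (norm_nonneg u).trans hun
  have hvh : ‖v‖ ≤ h := by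
    refine Real.le_sqrt_of_sq_le ?_
    rw [T.norm_sq_eq_add_norm_sq_projection v]
    gcongr
  have hwh : ‖w‖ ≤ h := by
    refine Real.le_sqrt_of_sq_le ?_
    have : ‖w‖ ^ 2 ≤ c ^ 2 := by gcongr
    linarith [sq_nonneg a]
  have hxv : infDist (x₀ + v) K ≤ ‖v‖ := by
    refine (infDist_le_dist_of_mem hx₀).trans_eq ?_
    rw [dist_eq_norm, add_sub_cancel_left]
  have hyw : infDist (x₀ + w) K = ‖w‖ :=
    infDist_add_normal hx₀ hT (Tᗮ.orthogonalProjectionOnto v).2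
      ((ENNReal.ofReal_le_ofReal hwh).trans_lt hreach)
  have hyp : x₀ ∈ proj K (x₀ + w) := ⟨hx₀, by rw [hyw, add_sub_cancel_left]⟩
  have hdiff : x₀ + v - (x₀ + w) = u := by rw [← huw]; abel
  have hlow : b - a ≤ infDist (x₀ + v) K := by
    have : infDist (x₀ + w) K ≤ infDist (x₀ + v) K + dist (x₀ + w) (x₀ + v) :=
      infDist_le_infDist_add_dist
    rw [hyw, dist_comm, dist_eq_norm, hdiff] at this
    linarith
  refine ⟨hlow, hxv.trans ?_, ?_⟩
  · rw [← huw]; exact (norm_add_le _ _).trans (by linarith)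
  obtain ⟨p, hp⟩ := exists_proj_eq_singleton (K := K) (x := x₀ + v)
    ((ENNReal.ofReal_le_ofReal (hxv.trans hvh)).trans_lt hreach)
  refine ⟨p, hp, ?_⟩
  have hlip := norm_sub_le_reachFactor_mul (by simp [hp] : p ∈ proj K (x₀ + v)) hyp
    (hxv.trans hvh) (hyw.le.trans hwh) hreach
  rw [hdiff] at hlip
  have hF : 0 ≤ reachFactor (reach K) h := by
    unfold reachFactor
    split_ifs with htop
    · exact zero_le_one
    · have := (ENNReal.ofReal_lt_iff_lt_toReal (Real.sqrt_nonneg _) htop).1 hreach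
      exact div_nonneg ENNReal.toReal_nonneg (by linarith)
  calc ‖p - x₀‖ ≤ reachFactor (reach K) h * ‖u‖ := hlip
    _ ≤ reachFactor (reach K) h * a := by gcongr
    _ = reachFactor (reach K) h * a / (b - a) * (b - a) := by field_simp
    _ ≤ _ := by gcongr

end Tube

theorem mainTheorem5 :
    ∃ α : ℝ, 0 < α ∧
      ∀ (n d : ℕ) (K : Set (EuclideanSpace ℝ (Fin n))),
        HasTangentSpacesOfDim d K →
      ∀ x₀ ∈ K, ∀ σ t : ℝ, 0 < σ → 0 < t →
        ENNReal.ofReal (σ * kappa n d t) < reach K →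
        0 < √((n : ℝ) - (d : ℝ)) - √(d : ℝ) - 2 * t →
      ∀ (Ω : Type*) [MeasurableSpace Ω] (P : Measure Ω) (ε : Ω → EuclideanSpace ℝ (Fin n)),
        HasLaw ε (stdGaussian (EuclideanSpace ℝ (Fin n))) P →
        ENNReal.ofReal ((1 - Real.exp (-α * t ^ 2)) ^ 2) ≤
          P {ω | σ * (√((n : ℝ) - (d : ℝ)) - √(d : ℝ) - 2 * t) ≤
                    Metric.infDist (x₀ + σ • ε ω) K ∧
                 Metric.infDist (x₀ + σ • ε ω) K ≤
                    σ * (√((n : ℝ) - (d : ℝ)) + √(d : ℝ) + 2 * t) ∧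
                 ∃ p, proj K (x₀ + σ • ε ω) = {p} ∧
                   ‖p - x₀‖ ≤
                     reachFactor (reach K) (σ * kappa n d t) * (√(d : ℝ) + t) /
                       (√((n : ℝ) - (d : ℝ)) - √(d : ℝ) - 2 * t) *
                     Metric.infDist (x₀ + σ • ε ω) K} := by
  refine ⟨1 / 1000000, by norm_num, ?_⟩
  intro n d K hK x₀ hx₀ σ t hσ ht hreach hgap Ω _ P ε hε
  obtain ⟨T, hT, rfl⟩ := hK x₀ hx₀
  set d := Module.finrank ℝ T with hd
  have hcodim : (n : ℝ) - d = Module.finrank ℝ Tᗮ := by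
    have := T.finrank_add_finrank_orthogonal
    rw [finrank_euclideanSpace_fin] at this
    rw [sub_eq_iff_eq_add', hd]
    exact_mod_cast this.symm
  have htT : t < √(Module.finrank ℝ Tᗮ : ℝ) := by
    rw [← hcodim]; linarith [Real.sqrt_nonneg (d : ℝ)]
  have hprob := le_stdGaussian_norm_projection T ht htT
  rw [← hcodim, ← hd, ← hε.map_eq, Measure.map_apply_of_aemeasurable hε.aemeasurable] at hprob
  swap
  · have h1 : Measurable fun x => ‖T.orthogonalProjectionOnto x‖ := by fun_prop
    have h2 : Measurable fun x => ‖Tᗮ.orthogonalProjectionOnto x‖ := by fun_prop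
    exact (measurableSet_le h1 measurable_const).inter
      ((measurableSet_le measurable_const h2).inter (measurableSet_le h2 measurable_const))
  refine hprob.trans (measure_mono fun ω hω => ?_)
  obtain ⟨h1, h2, h3⟩ := hω
  have hκ : σ * kappa n d t = √((σ * (√d + t)) ^ 2 + (σ * (√((n : ℝ) - d) + t)) ^ 2) := by
    rw [kappa, mul_pow, mul_pow, ← mul_add, Real.sqrt_mul (sq_nonneg σ), Real.sqrt_sq hσ.le]
  have hnorm : ∀ S : Submodule ℝ (EuclideanSpace ℝ (Fin n)),
      ‖S.orthogonalProjectionOnto (σ • ε ω)‖ = σ * ‖S.orthogonalProjectionOnto (ε ω)‖ :=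
    fun S => by rw [map_smul, norm_smul, Real.norm_of_nonneg hσ.le]
  have hsub : σ * (√((n : ℝ) - d) - t) - σ * (√d + t) = σ * (√((n : ℝ) - d) - √d - 2 * t) := by
    ring
  obtain ⟨g1, g2, p, hp, g3⟩ := projection_bounds (v := σ • ε ω) (a := σ * (√d + t))
    (b := σ * (√((n : ℝ) - d) - t)) (c := σ * (√((n : ℝ) - d) + t)) hx₀ hT (hκ ▸ hreach)
    (by rw [hnorm]; gcongr) (by rw [hnorm]; gcongr) (by rw [hnorm]; gcongr)
    (by rw [hsub]; positivity)
  rw [hsub] at g1 g3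
  refine ⟨g1, g2.trans_eq (by ring), p, hp, g3.trans_eq ?_⟩
  rw [← hκ, mul_left_comm, mul_div_mul_left _ _ hσ.ne']
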